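/- Let $n\ge 1$ and let $(M,g)$ be an $(n+1)$-dimensional spacetime, i.e. a smooth $(n+1)$-manifold with a smooth Lorentzian metric of signature $(-,+,\dots,+)$ and Levi-Civita connection $\nabla$. A smooth function $f:M\to\mathbb R$ is called a \emph{spacetime convex function} if its Hessian $\nabla_\mu\nabla_\nu f$ has Lorentzian signature at every point and there is a constant $c>0$ such that $V^\mu V^\nu\nabla_\mu\nabla_\nu f\ge c\,g_{\mu\nu}V^\mu V^\nu$ for every tangent vector $V\in TM$. Suppose that $(M,g)$ admits a spacetime convex function. Let $\Sigma\subset M$ be a nonempty smoothly embedded spacelike hypersurface, i.e. an embedded $n$-dimensional manifold (without boundary) whose induced metric $h_{ij}$ is positive definite, and suppose that $\Sigma$ is \emph{maximal}, i.e. $h^{ij}K_{ij}=0$ at every point, where $K_{ij}=g(t,\nabla_{\partial_i}\partial_j)$ is the second fundamental form with respect to a unit timelike normal $t$. Then $\Sigma$ is not closed, i.e. $\Sigma$ is not compact. -/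

import Mathlib

open scoped Manifold ContDiff

noncomputable section

namespace SpacetimeConvex

/-- The quadratic form `v ↦ B v v` has Lorentzian signature `(-, +, …, +)`: one negative square,
all the others positive. -/
def IsLorentzian {V : Type*} [AddCommGroup V] [Module ℝ V] (B : LinearMap.BilinForm ℝ V) : Prop :=
  sigNeg (LinearMap.BilinMap.toQuadraticMap B) = 1 ∧
    sigPos (LinearMap.BilinMap.toQuadraticMap B) + 1 = Module.finrank ℝ V

/-- A smooth Lorentzian metric on a smooth manifold `M` of dimension `n + 1`. -/
structure LorentzMetric (n : ℕ) (M : Type*) [TopologicalSpace M]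
    [ChartedSpace (EuclideanSpace ℝ (Fin (n + 1))) M] [IsManifold (𝓡 (n + 1)) ∞ M] where
  /-- The scalar product on each tangent space. -/
  val (x : M) : TangentSpace (𝓡 (n + 1)) x →L[ℝ] TangentSpace (𝓡 (n + 1)) x →L[ℝ] ℝ
  symm (x : M) (v w : TangentSpace (𝓡 (n + 1)) x) : val x v w = val x w v
  lorentzian (x : M) : IsLorentzian (val x).toBilinForm
  contMDiff : ContMDiff (𝓡 (n + 1))
    ((𝓡 (n + 1)).prod 𝓘(ℝ, EuclideanSpace ℝ (Fin (n + 1)) →L[ℝ]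
      EuclideanSpace ℝ (Fin (n + 1)) →L[ℝ] ℝ)) ∞
    (fun x ↦ Bundle.TotalSpace.mk' (EuclideanSpace ℝ (Fin (n + 1)) →L[ℝ]
      EuclideanSpace ℝ (Fin (n + 1)) →L[ℝ] ℝ) x (val x))

section Spacetime

variable {n : ℕ} {M : Type*} [TopologicalSpace M]
  [ChartedSpace (EuclideanSpace ℝ (Fin (n + 1))) M] [IsManifold (𝓡 (n + 1)) ∞ M]

/-- The components `g_μν(y) = g(∂_μ, ∂_ν)` of the metric in the preferred chart at `x`, as a
function of the coordinates `y`: the pullback of `g` by the inverse of that chart. -/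
def metricMatrix (g : LorentzMetric n M) (x : M) (y : EuclideanSpace ℝ (Fin (n + 1))) :
    Matrix (Fin (n + 1)) (Fin (n + 1)) ℝ :=
  Matrix.of fun μ ν ↦ g.val ((extChartAt (𝓡 (n + 1)) x).symm y)
    (mfderiv 𝓘(ℝ, EuclideanSpace ℝ (Fin (n + 1))) (𝓡 (n + 1))
      (extChartAt (𝓡 (n + 1)) x).symm y (EuclideanSpace.single μ (1 : ℝ)))
    (mfderiv 𝓘(ℝ, EuclideanSpace ℝ (Fin (n + 1))) (𝓡 (n + 1))
      (extChartAt (𝓡 (n + 1)) x).symm y (EuclideanSpace.single ν (1 : ℝ)))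

/-- The partial derivative `∂_σ g_μν` at `x`, in the preferred chart at `x`. -/
def metricDeriv (g : LorentzMetric n M) (x : M) (σ μ ν : Fin (n + 1)) : ℝ :=
  fderiv ℝ (fun y ↦ metricMatrix g x y μ ν) (extChartAt (𝓡 (n + 1)) x x)
    (EuclideanSpace.single σ (1 : ℝ))

/-- The Christoffel symbol of the Levi-Civita connection at `x`, in the preferred chart at `x`:
`Γ^κ_μν = 1/2 ∑_σ g^κσ (∂_μ g_νσ + ∂_ν g_μσ - ∂_σ g_μν)`. -/
def christoffelSymbol (g : LorentzMetric n M) (x : M) (κ μ ν : Fin (n + 1)) : ℝ :=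
  1 / 2 * ∑ σ, (metricMatrix g x (extChartAt (𝓡 (n + 1)) x x))⁻¹ κ σ *
    (metricDeriv g x μ ν σ + metricDeriv g x ν μ σ - metricDeriv g x σ μ ν)

/-- The vector `Γ(v, w) = ∑ Γ^κ_μν v^μ w^ν ∂_κ` at `x`, in the preferred chart at `x`. (In Mathlib
the tangent space at `x` is `EuclideanSpace ℝ (Fin (n + 1))`, the components of a tangent vector
being its components in the preferred chart at `x`.) -/
def christoffel (g : LorentzMetric n M) (x : M) (v w : EuclideanSpace ℝ (Fin (n + 1))) :
    EuclideanSpace ℝ (Fin (n + 1)) :=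
  WithLp.toLp 2 fun κ ↦ ∑ μ, ∑ ν, christoffelSymbol g x κ μ ν * v μ * w ν

theorem christoffel_add_left (g : LorentzMetric n M) (x : M)
    (v v' w : EuclideanSpace ℝ (Fin (n + 1))) :
    christoffel g x (v + v') w = christoffel g x v w + christoffel g x v' w := by
  ext κ
  simp [christoffel, mul_add, add_mul, Finset.sum_add_distrib]

theorem christoffel_smul_left (g : LorentzMetric n M) (x : M) (c : ℝ)
    (v w : EuclideanSpace ℝ (Fin (n + 1))) :
    christoffel g x (c • v) w = c • christoffel g x v w := by
  ext κ
  simp only [christoffel, PiLp.smul_apply, smul_eq_mul, Finset.mul_sum]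
  exact Finset.sum_congr rfl fun μ _ ↦ Finset.sum_congr rfl fun ν _ ↦ by ring

theorem christoffel_add_right (g : LorentzMetric n M) (x : M)
    (v w w' : EuclideanSpace ℝ (Fin (n + 1))) :
    christoffel g x v (w + w') = christoffel g x v w + christoffel g x v w' := by
  ext κ
  simp [christoffel, mul_add, Finset.sum_add_distrib]

theorem christoffel_smul_right (g : LorentzMetric n M) (x : M) (c : ℝ)
    (v w : EuclideanSpace ℝ (Fin (n + 1))) :
    christoffel g x v (c • w) = c • christoffel g x v w := by
  ext κ
  simp only [christoffel, PiLp.smul_apply, smul_eq_mul, Finset.mul_sum]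
  exact Finset.sum_congr rfl fun μ _ ↦ Finset.sum_congr rfl fun ν _ ↦ by ring

/-- The function `f` in the preferred chart at `x`, as a function of the coordinates. -/
def inChart (f : M → ℝ) (x : M) (y : EuclideanSpace ℝ (Fin (n + 1))) : ℝ :=
  f ((extChartAt (𝓡 (n + 1)) x).symm y)

/-- The Hessian `V^μ W^ν ∇_μ ∇_ν f = V^μ W^ν (∂_μ ∂_ν f - Γ^κ_μν ∂_κ f)` at `x`, for the Levi-Civita
connection, computed in the preferred chart at `x`. (It is a tensor: any other chart gives the same
bilinear form on the tangent space.) -/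
def hessian (g : LorentzMetric n M) (f : M → ℝ) (x : M) :
    LinearMap.BilinForm ℝ (TangentSpace (𝓡 (n + 1)) x) :=
  LinearMap.mk₂ ℝ (M := EuclideanSpace ℝ (Fin (n + 1))) (Nₗ := EuclideanSpace ℝ (Fin (n + 1)))
    (fun v w ↦ fderiv ℝ (fderiv ℝ (inChart f x)) (extChartAt (𝓡 (n + 1)) x x) v w -
      fderiv ℝ (inChart f x) (extChartAt (𝓡 (n + 1)) x x) (christoffel g x v w))
    (fun v v' w ↦ by simp only [christoffel_add_left, map_add, _root_.add_apply]; ring)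
    (fun c v w ↦ by
      simp only [christoffel_smul_left, map_smul, _root_.smul_apply, smul_eq_mul]; ring)
    (fun v w w' ↦ by simp only [christoffel_add_right, map_add]; ring)
    (fun c v w ↦ by simp only [christoffel_smul_right, map_smul, smul_eq_mul]; ring)

/-- `f` is a spacetime convex function: it is smooth, its Hessian has Lorentzian signature at every
point, and `∇_μ ∇_ν f ≥ c g_μν` on `M` for some constant `c > 0`. -/
def IsSpacetimeConvex (g : LorentzMetric n M) (f : M → ℝ) : Prop :=
  ContMDiff (𝓡 (n + 1)) 𝓘(ℝ, ℝ) ∞ f ∧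
  (∀ x : M, IsLorentzian (hessian g f x)) ∧
  ∃ c : ℝ, 0 < c ∧ ∀ (x : M) (v : TangentSpace (𝓡 (n + 1)) x),
    c * g.val x v v ≤ hessian g f x v v

variable {S : Type*} [TopologicalSpace S] [ChartedSpace (EuclideanSpace ℝ (Fin n)) S]

/-- The first fundamental form `h = ι^* g` at `p`. -/
def inducedMetric (g : LorentzMetric n M) (ι : S → M) (p : S)
    (v w : TangentSpace (𝓡 n) p) : ℝ :=
  g.val (ι p) (mfderiv (𝓡 n) (𝓡 (n + 1)) ι p v) (mfderiv (𝓡 n) (𝓡 (n + 1)) ι p w)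

/-- `ι : S → M` is an embedded spacelike hypersurface: a smooth embedding of an `n`-dimensional
manifold whose induced metric is positive definite. -/
def IsSpacelikeHypersurface (g : LorentzMetric n M) (ι : S → M) : Prop :=
  Manifold.IsSmoothEmbedding (𝓡 n) (𝓡 (n + 1)) ∞ ι ∧
  ∀ (p : S) (v : TangentSpace (𝓡 n) p), v ≠ 0 → 0 < inducedMetric g ι p v v

/-- `t` is a unit timelike normal to the hypersurface at `ι p`. -/
def IsUnitNormal (g : LorentzMetric n M) (ι : S → M) (p : S)
    (t : TangentSpace (𝓡 (n + 1)) (ι p)) : Prop :=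
  g.val (ι p) t t = -1 ∧
    ∀ v : TangentSpace (𝓡 n) p, g.val (ι p) t (mfderiv (𝓡 n) (𝓡 (n + 1)) ι p v) = 0

/-- The ambient covariant derivative `∇_i ∂_j x^μ = ∂_i ∂_j x^μ + Γ^μ_νσ ∂_i x^ν ∂_j x^σ` of the
tangent vectors of the hypersurface `x^μ = ι^μ` at `p`, in the preferred charts at `p` and `ι p`.
(Its component normal to the hypersurface does not depend on the charts.) -/
def tangentDeriv (g : LorentzMetric n M) (ι : S → M) (p : S) (v w : TangentSpace (𝓡 n) p) :
    TangentSpace (𝓡 (n + 1)) (ι p) :=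
  let u : EuclideanSpace ℝ (Fin n) → EuclideanSpace ℝ (Fin (n + 1)) :=
    fun z ↦ extChartAt (𝓡 (n + 1)) (ι p) (ι ((extChartAt (𝓡 n) p).symm z))
  fderiv ℝ (fderiv ℝ u) (extChartAt (𝓡 n) p p) v w +
    christoffel g (ι p) (mfderiv (𝓡 n) (𝓡 (n + 1)) ι p v) (mfderiv (𝓡 n) (𝓡 (n + 1)) ι p w)

/-- The second fundamental form `K(v, w) = g(t, ∇_v w)` with respect to the normal `t`. -/
def secondFundamentalForm (g : LorentzMetric n M) (ι : S → M) (p : S)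
    (t : TangentSpace (𝓡 (n + 1)) (ι p)) (v w : TangentSpace (𝓡 n) p) : ℝ :=
  g.val (ι p) t (tangentDeriv g ι p v w)

/-- The coordinate vector `∂_i` at `p` of the preferred chart at `p`. -/
def coordVec (p : S) (i : Fin n) : TangentSpace (𝓡 n) p :=
  (EuclideanSpace.single i (1 : ℝ) : EuclideanSpace ℝ (Fin n))

/-- The trace `h^ij K_ij` of the second fundamental form with respect to the normal `t`. -/
def traceSecondFundamentalForm (g : LorentzMetric n M) (ι : S → M) (p : S)
    (t : TangentSpace (𝓡 (n + 1)) (ι p)) : ℝ :=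
  ∑ i, ∑ j, (Matrix.of fun i j ↦ inducedMetric g ι p (coordVec p i) (coordVec p j))⁻¹ i j *
    secondFundamentalForm g ι p t (coordVec p i) (coordVec p j)

/-- The hypersurface is maximal: `h^ij K_ij = 0` everywhere. (The unit normal is unique up to sign,
and the sign does not matter here.) -/
def IsMaximal (g : LorentzMetric n M) (ι : S → M) : Prop :=
  ∀ (p : S) (t : TangentSpace (𝓡 (n + 1)) (ι p)), IsUnitNormal g ι p t →
    traceSecondFundamentalForm g ι p t = 0

end Spacetime

end SpacetimeConvex

end

/-! If the hypersurface is compact, `f ∘ ι` attains a maximum at some `p`. There `df` vanishes on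
tangent vectors, so it equals `r * g(t, ·)` for a unit timelike normal `t` and some real `r`.
Differentiating twice along the hypersurface gives the Gauss-type identity `(f ∘ ι)''(v, v) = Hess
f(v, v) + df(∇_v v)`, whose last term is `r * K(v, v)`. The left side is nonpositive at a maximum,
and `Hess f ≥ c g`, so `c * h(v, v) + r * K(v, v) ≤ 0` for each tangent `v`. Taking the `h`-trace
removes `K` by maximality, whatever `r` is, and leaves `c * n ≤ 0`, a contradiction. The main
ingredients are `fderiv_fderiv_inChart_comp` (the identity), `exists_unit_normal` (the form of `df`)
and `exists_sum_inv_mul_eq` (the trace). -/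

namespace SpacetimeConvex

open Filter Topology

/-! ### Second-order calculus in normed spaces. -/

/-- The chain rule for the second derivative. -/
theorem fderiv_fderiv_comp {E F : Type*} [NormedAddCommGroup E] [NormedSpace ℝ E]
    [NormedAddCommGroup F] [NormedSpace ℝ F] {u : E → F} {f : F → ℝ} {z : E}
    (hu : ContDiffAt ℝ 2 u z) (hf : ContDiffAt ℝ 2 f (u z)) (v w : E) :
    fderiv ℝ (fderiv ℝ (f ∘ u)) z v w =
      fderiv ℝ (fderiv ℝ f) (u z) (fderiv ℝ u z v) (fderiv ℝ u z w) +
        fderiv ℝ f (u z) (fderiv ℝ (fderiv ℝ u) z v w) := by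
  have hu' : ∀ᶠ y in 𝓝 z, DifferentiableAt ℝ u y :=
    (hu.eventually (by simp)).mono fun y hy ↦ hy.differentiableAt (by simp)
  have hf' : ∀ᶠ y in 𝓝 z, DifferentiableAt ℝ f (u y) :=
    hu.continuousAt.eventually
      ((hf.eventually (by simp)).mono fun y hy ↦ hy.differentiableAt (by simp))
  have hev : fderiv ℝ (f ∘ u) =ᶠ[𝓝 z] fun y ↦ (fderiv ℝ f (u y)).comp (fderiv ℝ u y) := by
    filter_upwards [hu', hf'] with y hy hy' using fderiv_comp y hy' hy
  have hdu : HasFDerivAt (fderiv ℝ u) (fderiv ℝ (fderiv ℝ u) z) z :=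
    ((hu.fderiv_right (m := 1) (by norm_num)).differentiableAt (by simp)).hasFDerivAt
  have hdf : HasFDerivAt (fderiv ℝ f) (fderiv ℝ (fderiv ℝ f) (u z)) (u z) :=
    ((hf.fderiv_right (m := 1) (by norm_num)).differentiableAt (by simp)).hasFDerivAt
  have hu1 : HasFDerivAt u (fderiv ℝ u z) z := (hu.differentiableAt (by simp)).hasFDerivAt
  have h := (hdf.comp z hu1).clm_comp hdu
  simp only [Function.comp_apply] at h
  rw [hev.fderiv_eq, h.fderiv]
  simp [add_comm]

/-- At a local maximum the second derivative is negative semidefinite. -/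
theorem fderiv_fderiv_nonpos_of_isLocalMax {E : Type*} [NormedAddCommGroup E] [NormedSpace ℝ E]
    {F : E → ℝ} {z : E} (hF : ContDiffAt ℝ 2 F z) (hmax : IsLocalMax F z) (v : E) :
    fderiv ℝ (fderiv ℝ F) z v v ≤ 0 := by
  by_contra! hpos
  set γ : ℝ → E := fun s ↦ z + s • v with hγ
  have hγ0 : γ 0 = z := by simp [hγ]
  have hγd (s : ℝ) : HasDerivAt γ v s := by
    simpa [hγ] using ((hasDerivAt_id s).smul_const v).const_add z
  have hγt : Tendsto γ (𝓝 0) (𝓝 z) := by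
    simpa [ContinuousAt, hγ0] using (hγd 0).continuousAt
  have hF' : ∀ᶠ y in 𝓝 z, DifferentiableAt ℝ F y :=
    (hF.eventually (by simp)).mono fun y hy ↦ hy.differentiableAt (by simp)
  have h1 : deriv (F ∘ γ) =ᶠ[𝓝 0] fun s ↦ fderiv ℝ F (γ s) v := by
    filter_upwards [hγt.eventually hF'] with s hs
    exact (hs.hasFDerivAt.comp_hasDerivAt s (hγd s)).deriv
  have hdF : HasFDerivAt (fderiv ℝ F) (fderiv ℝ (fderiv ℝ F) z) (γ 0) := by
    rw [hγ0]
    exact ((hF.fderiv_right (m := 1) (by norm_num)).differentiableAt (by simp)).hasFDerivAt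
  have h2 : deriv (deriv (F ∘ γ)) 0 = fderiv ℝ (fderiv ℝ F) z v v := by
    rw [h1.deriv_eq]
    simpa using ((hdF.comp_hasDerivAt 0 (hγd 0)).clm_apply (hasDerivAt_const 0 v)).deriv
  have h3 : deriv (F ∘ γ) 0 = 0 := by
    simp [h1.self_of_nhds, hγ0, hmax.fderiv_eq_zero]
  have hcont : ContinuousAt (F ∘ γ) 0 :=
    ContinuousAt.comp (by rw [hγ0]; exact hF.continuousAt) (hγd 0).continuousAt
  -- A positive second derivative would make 0 a local minimum as well as a local maximum, so `F ∘
  -- γ` would be locally constant and its second derivative zero.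
  have hmin : IsLocalMin (F ∘ γ) 0 := isLocalMin_of_deriv_deriv_pos (by rw [h2]; exact hpos) h3 hcont
  have hconst : (F ∘ γ) =ᶠ[𝓝 0] fun _ ↦ F z := by
    filter_upwards [hmin, hγt.eventually hmax] with s hs hs'
    refine le_antisymm hs' ?_
    simpa [hγ0] using hs
  have h4 : deriv (deriv (F ∘ γ)) 0 = 0 := by
    rw [hconst.deriv.deriv_eq]
    simp
  linarith

/-! ### Linear algebra: unit normals and traces. -/

/-- A Lorentzian form has a timelike vector. -/
theorem IsLorentzian.exists_neg {V : Type*} [AddCommGroup V] [Module ℝ V] [Module.Finite ℝ V]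
    {B : LinearMap.BilinForm ℝ V} (hB : IsLorentzian B) : ∃ e, B e e < 0 := by
  obtain ⟨W, hW, hneg⟩ :=
    exists_finrank_eq_sigNeg_and_negDef (LinearMap.BilinMap.toQuadraticMap B)
  rw [hB.1] at hW
  have : Nontrivial W := Module.nontrivial_of_finrank_pos (R := ℝ) (by omega)
  obtain ⟨e, he⟩ := exists_ne (0 : W)
  refine ⟨e, ?_⟩
  simpa using hneg e he

/-- A hyperplane on which a bilinear form with a timelike vector is positive definite has a unit
timelike normal, and any linear form vanishing on the hyperplane is a multiple of the pairing with
that normal. -/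
theorem exists_unit_normal {E V : Type*} [AddCommGroup E] [Module ℝ E] [Module.Finite ℝ E]
    [AddCommGroup V] [Module ℝ V] [Module.Finite ℝ V]
    (hdim : Module.finrank ℝ V = Module.finrank ℝ E + 1)
    (G : LinearMap.BilinForm ℝ V) (hsymm : ∀ v w, G v w = G w v) (L : E →ₗ[ℝ] V)
    (hL : ∀ v, v ≠ 0 → 0 < G (L v) (L v)) {e : V} (he : G e e < 0)
    (P : V →ₗ[ℝ] ℝ) (hP : ∀ v, P (L v) = 0) :
    ∃ t, G t t = -1 ∧ (∀ v, G t (L v) = 0) ∧ ∃ r : ℝ, ∀ x, P x = r * G t x := by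
  have hinj : Function.Injective (G.compl₁₂ L L) := by
    rw [injective_iff_map_eq_zero]
    intro v hv
    by_contra hne
    have := hL v hne
    have h0 : G (L v) (L v) = 0 := by simpa using congr($hv v)
    linarith
  have hsurj : Function.Surjective (G.compl₁₂ L L) :=
    (LinearMap.injective_iff_surjective_of_finrank_eq_finrank
      (by rw [Subspace.dual_finrank_eq])).1 hinj
  -- `L a` is the `G`-orthogonal projection of `e` onto the hyperplane; it exists because the
  -- restricted form is nondegenerate. The remainder `s` is normal, and by Pythagoras still
  -- timelike.
  obtain ⟨a, ha⟩ := hsurj ((G e).comp L)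
  have ha' (v : E) : G (L a) (L v) = G e (L v) := by simpa using congr($ha v)
  set s := e - L a with hs
  have hsL (v : E) : G s (L v) = 0 := by simp [hs, ha']
  have haa : 0 ≤ G (L a) (L a) := by
    rcases eq_or_ne a 0 with rfl | h
    · simp
    · exact (hL a h).le
  have hss : G s s < 0 := by
    have h1 : G s s = G e e - G (L a) (L a) := by
      have : G s s = G s e - G s (L a) := by rw [← map_sub]
      rw [this, hsL, hs, map_sub, LinearMap.sub_apply, hsymm (L a) e, ← ha']
      ring
    linarith
  set q := √(-G s s) with hq
  have hqpos : 0 < q := Real.sqrt_pos.2 (by linarith)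
  have hqq : q * q = -G s s := Real.mul_self_sqrt (by linarith)
  have htt : G (q⁻¹ • s) (q⁻¹ • s) = -1 := by
    simp only [map_smul, LinearMap.smul_apply, smul_eq_mul]
    rw [show G s s = -(q * q) by linarith]
    field_simp
  have htL (v : E) : G (q⁻¹ • s) (L v) = 0 := by simp [hsL]
  -- The value of `r` is forced by evaluating at the normal itself, where `G t t = -1`.
  refine ⟨q⁻¹ • s, htt, htL, -P (q⁻¹ • s), ?_⟩
  generalize q⁻¹ • s = t at htt htL
  have hLinj : Function.Injective L := by
    rw [injective_iff_map_eq_zero]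
    intro v hv
    by_contra hne
    have := hL v hne
    simp [hv] at this
  have htn : t ∉ LinearMap.range L := by
    rintro ⟨v, rfl⟩
    have := htL v
    linarith
  -- The range of `L` has codimension one and misses `t`, so adding `t` fills the space.
  have htop : LinearMap.range L ⊔ Submodule.span ℝ {t} = ⊤ := by
    apply Submodule.eq_top_of_finrank_eq
    have hlt : LinearMap.range L < LinearMap.range L ⊔ Submodule.span ℝ {t} := by
      refine lt_of_le_of_ne le_sup_left fun h ↦ htn ?_
      rw [h]
      exact Submodule.mem_sup_right (Submodule.mem_span_singleton_self t)
    have h1 := Submodule.finrank_lt_finrank_of_lt hlt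
    rw [LinearMap.finrank_range_of_inj hLinj] at h1
    have h2 := Submodule.finrank_le (LinearMap.range L ⊔ Submodule.span ℝ {t})
    omega
  intro x
  obtain ⟨_, ⟨v, rfl⟩, _, hy, rfl⟩ := Submodule.mem_sup.1 (htop ▸ Submodule.mem_top : x ∈ _)
  obtain ⟨r, rfl⟩ := Submodule.mem_span_singleton.1 hy
  simp [hP, htL, htt, mul_comm]

open Matrix in
/-- The trace of a bilinear form with respect to a positive definite matrix is a sum of values of
the quadratic form. -/
theorem exists_sum_inv_mul_eq {n : ℕ} {H : Matrix (Fin n) (Fin n) ℝ} (hH : H.PosDef) :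
    ∃ b : Fin n → EuclideanSpace ℝ (Fin n),
      ∀ T : LinearMap.BilinForm ℝ (EuclideanSpace ℝ (Fin n)),
        ∑ i, ∑ j, H⁻¹ i j * T (EuclideanSpace.single i 1) (EuclideanSpace.single j 1) =
          ∑ k, T (b k) (b k) := by
  obtain ⟨B, hB⟩ : ∃ B : Matrix (Fin n) (Fin n) ℝ, H⁻¹ = Bᴴ * B := by
    open scoped MatrixOrder in
    exact CStarAlgebra.nonneg_iff_eq_star_mul_self.1 hH.inv.posSemidef.nonneg
  -- The vectors are the rows of `B`; since `H⁻¹ = Bᴴ * B`, they are orthonormal for the form with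
  -- Gram matrix `H`.
  refine ⟨fun k ↦ ∑ i, B k i • EuclideanSpace.single i (1 : ℝ), fun T ↦ ?_⟩
  simp only [hB, Matrix.mul_apply, conjTranspose_apply, star_trivial, Finset.sum_mul, map_sum,
    LinearMap.sum_apply, map_smul, LinearMap.smul_apply, smul_eq_mul, Finset.mul_sum]
  rw [Finset.sum_congr rfl fun i _ ↦ Finset.sum_comm, Finset.sum_comm]
  refine Finset.sum_congr rfl fun k _ ↦ ?_
  rw [Finset.sum_comm]
  exact Finset.sum_congr rfl fun j _ ↦ Finset.sum_congr rfl fun i _ ↦ by ring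

/-- The Gram matrix of a positive definite form in the standard basis is positive definite. -/
theorem posDef_of_single {n : ℕ} (B : LinearMap.BilinForm ℝ (EuclideanSpace ℝ (Fin n)))
    (hsymm : ∀ v w, B v w = B w v) (hpos : ∀ v, v ≠ 0 → 0 < B v v) :
    (Matrix.of fun i j ↦ B (EuclideanSpace.single i 1) (EuclideanSpace.single j 1)).PosDef := by
  rw [Matrix.posDef_iff_dotProduct_mulVec]
  refine ⟨Matrix.IsHermitian.ext fun i j ↦ by simp [hsymm], fun x hx ↦ ?_⟩
  have hx' : WithLp.toLp 2 x = ∑ i, x i • EuclideanSpace.single i (1 : ℝ) := by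
    ext i
    simp [Finset.sum_apply, Pi.single_apply]
  have h := hpos (WithLp.toLp 2 x) (by simpa using hx)
  rw [hx'] at h
  simp only [map_sum, LinearMap.sum_apply, map_smul, LinearMap.smul_apply, smul_eq_mul] at h
  simpa [dotProduct, Matrix.mulVec, hsymm, mul_comm] using h

/-- The inverse of a positive definite form contracted with the form itself is the dimension. -/
theorem sum_inv_mul_self {n : ℕ} {H : Matrix (Fin n) (Fin n) ℝ} (hH : H.PosDef) :
    ∑ i, ∑ j, H⁻¹ i j * H i j = n := by
  have hinv : H⁻¹ * H = 1 := Matrix.nonsing_inv_mul H hH.det_pos.ne'.isUnit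
  have h : (H⁻¹ * H).trace = n := by simp [hinv]
  rw [← h, Matrix.trace]
  refine Finset.sum_congr rfl fun i _ ↦ ?_
  rw [Matrix.diag_apply, Matrix.mul_apply]
  refine Finset.sum_congr rfl fun j _ ↦ ?_
  rw [← hH.isHermitian.apply i j, star_trivial]

/-! ### The function and the hypersurface in preferred charts. -/

noncomputable section Spacetime

variable {n : ℕ} {M : Type*} [TopologicalSpace M]
  [ChartedSpace (EuclideanSpace ℝ (Fin (n + 1))) M]

theorem contDiffAt_inChart {f : M → ℝ} (hf : ContMDiff (𝓡 (n + 1)) 𝓘(ℝ, ℝ) ∞ f) (x : M) :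
    ContDiffAt ℝ ∞ (inChart f x) (extChartAt (𝓡 (n + 1)) x x) := by
  have h := (contMDiffAt_iff.1 (hf x)).2
  rw [modelWithCornersSelf_coe, Set.range_id, contDiffWithinAt_univ] at h
  exact h

variable {S : Type*} [TopologicalSpace S] [ChartedSpace (EuclideanSpace ℝ (Fin n)) S]

/-- The hypersurface map `ι` in the preferred charts at `p` and `ι p`. -/
def mapInCharts (ι : S → M) (p : S) (z : EuclideanSpace ℝ (Fin n)) :
    EuclideanSpace ℝ (Fin (n + 1)) :=
  extChartAt (𝓡 (n + 1)) (ι p) (ι ((extChartAt (𝓡 n) p).symm z))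

/-- The derivative of the hypersurface map `ι` in the preferred charts at `p` and `ι p`. -/
def derivInCharts (ι : S → M) (p : S) :
    EuclideanSpace ℝ (Fin n) →L[ℝ] EuclideanSpace ℝ (Fin (n + 1)) :=
  fderiv ℝ (mapInCharts ι p) (extChartAt (𝓡 n) p p)

theorem contDiffAt_mapInCharts {ι : S → M} (hι : ContMDiff (𝓡 n) (𝓡 (n + 1)) ∞ ι) (p : S) :
    ContDiffAt ℝ ∞ (mapInCharts ι p) (extChartAt (𝓡 n) p p) := by
  have h := (contMDiffAt_iff.1 (hι p)).2
  rw [modelWithCornersSelf_coe, Set.range_id, contDiffWithinAt_univ] at h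
  exact h

theorem mapInCharts_self (ι : S → M) (p : S) :
    mapInCharts ι p (extChartAt (𝓡 n) p p) = extChartAt (𝓡 (n + 1)) (ι p) (ι p) := by
  simp [mapInCharts]

theorem mfderiv_eq_derivInCharts {ι : S → M} (hι : ContMDiff (𝓡 n) (𝓡 (n + 1)) ∞ ι) (p : S) :
    mfderiv (𝓡 n) (𝓡 (n + 1)) ι p = derivInCharts ι p := by
  refine (if_pos ((hι p).mdifferentiableAt (by simp))).trans ?_
  rw [modelWithCornersSelf_coe, Set.range_id, fderivWithin_univ]
  rfl

/-- The function `f ∘ ι` read in charts has a local maximum where `f ∘ ι` has a maximum. -/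
theorem isLocalMax_inChart_comp {f : M → ℝ} {ι : S → M} (hι : Continuous ι) {p : S}
    (hp : ∀ q, f (ι q) ≤ f (ι p)) :
    IsLocalMax (inChart f (ι p) ∘ mapInCharts ι p) (extChartAt (𝓡 n) p p) := by
  have hcont : ContinuousAt (fun z ↦ ι ((extChartAt (𝓡 n) p).symm z)) (extChartAt (𝓡 n) p p) :=
    hι.continuousAt.comp (continuousAt_extChartAt_symm p)
  have hmem : (extChartAt (𝓡 (n + 1)) (ι p)).source ∈
      𝓝 (ι ((extChartAt (𝓡 n) p).symm (extChartAt (𝓡 n) p p))) := by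
    rw [extChartAt_to_inv]
    exact extChartAt_source_mem_nhds (ι p)
  -- The chart at `ι p` is inverted by its `symm` only on its source, which `ι` reaches for
  -- coordinates near those of `p`.
  filter_upwards [hcont.eventually_mem hmem] with z hz
  simp only [Function.comp_apply, inChart, extChartAt_to_inv, mapInCharts,
    PartialEquiv.left_inv _ hz]
  exact hp _

variable [IsManifold (𝓡 (n + 1)) ∞ M]

/-! ### The geometric tensors as bilinear maps on coordinate spaces. -/

/-- The metric at `x` as a bilinear form in the coordinates of the preferred chart at `x`. -/
def metricForm (g : LorentzMetric n M) (x : M) :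
    LinearMap.BilinForm ℝ (EuclideanSpace ℝ (Fin (n + 1))) :=
  (g.val x).toBilinForm

theorem exists_metricForm_neg (g : LorentzMetric n M) (x : M) : ∃ e, metricForm g x e e < 0 :=
  IsLorentzian.exists_neg (V := EuclideanSpace ℝ (Fin (n + 1))) (g.lorentzian x)

/-- The Christoffel symbols at `x` as a bilinear map. -/
def christoffelBilin (g : LorentzMetric n M) (x : M) :
    EuclideanSpace ℝ (Fin (n + 1)) →ₗ[ℝ] EuclideanSpace ℝ (Fin (n + 1)) →ₗ[ℝ]
      EuclideanSpace ℝ (Fin (n + 1)) :=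
  LinearMap.mk₂ ℝ (christoffel g x) (christoffel_add_left g x) (christoffel_smul_left g x)
    (christoffel_add_right g x) (christoffel_smul_right g x)

/-- The first fundamental form as a bilinear form in coordinates. -/
def inducedBilin (g : LorentzMetric n M) (ι : S → M) (p : S) :
    LinearMap.BilinForm ℝ (EuclideanSpace ℝ (Fin n)) :=
  (metricForm g (ι p)).compl₁₂ (derivInCharts ι p).toLinearMap (derivInCharts ι p).toLinearMap

theorem inducedMetric_eq (g : LorentzMetric n M) {ι : S → M}
    (hι : ContMDiff (𝓡 n) (𝓡 (n + 1)) ∞ ι) (p : S) (v w : EuclideanSpace ℝ (Fin n)) :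
    inducedMetric g ι p v w = inducedBilin g ι p v w := by
  unfold inducedMetric
  rw [mfderiv_eq_derivInCharts hι p]
  rfl

/-- The ambient covariant derivative of tangent vectors as a bilinear map in coordinates. -/
def tangentDerivBilin (g : LorentzMetric n M) (ι : S → M) (p : S) :
    EuclideanSpace ℝ (Fin n) →ₗ[ℝ] EuclideanSpace ℝ (Fin n) →ₗ[ℝ]
      EuclideanSpace ℝ (Fin (n + 1)) :=
  (fderiv ℝ (fderiv ℝ (mapInCharts ι p)) (extChartAt (𝓡 n) p p)).toLinearMap₁₂ +
    (christoffelBilin g (ι p)).compl₁₂ (derivInCharts ι p).toLinearMap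
      (derivInCharts ι p).toLinearMap

theorem tangentDerivBilin_apply (g : LorentzMetric n M) (ι : S → M) (p : S)
    (v w : EuclideanSpace ℝ (Fin n)) :
    tangentDerivBilin g ι p v w =
      fderiv ℝ (fderiv ℝ (mapInCharts ι p)) (extChartAt (𝓡 n) p p) v w +
        christoffel g (ι p) (derivInCharts ι p v) (derivInCharts ι p w) := rfl

theorem tangentDeriv_eq (g : LorentzMetric n M) {ι : S → M}
    (hι : ContMDiff (𝓡 n) (𝓡 (n + 1)) ∞ ι) (p : S) (v w : EuclideanSpace ℝ (Fin n)) :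
    tangentDeriv g ι p v w = tangentDerivBilin g ι p v w := by
  unfold tangentDeriv
  rw [mfderiv_eq_derivInCharts hι p]
  rfl

/-- The Hessian at `x` as a bilinear form in the coordinates of the preferred chart at `x`. -/
def hessianForm (g : LorentzMetric n M) (f : M → ℝ) (x : M) :
    LinearMap.BilinForm ℝ (EuclideanSpace ℝ (Fin (n + 1))) :=
  hessian g f x

theorem hessianForm_apply (g : LorentzMetric n M) (f : M → ℝ) (x : M)
    (v w : EuclideanSpace ℝ (Fin (n + 1))) :
    hessianForm g f x v w =
      fderiv ℝ (fderiv ℝ (inChart f x)) (extChartAt (𝓡 (n + 1)) x x) v w -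
        fderiv ℝ (inChart f x) (extChartAt (𝓡 (n + 1)) x x) (christoffel g x v w) := rfl

/-- The second derivative of `f ∘ ι` is the Hessian of `f` plus the derivative of `f` along the
covariant derivative of the tangent vectors. -/
theorem fderiv_fderiv_inChart_comp (g : LorentzMetric n M) {f : M → ℝ}
    (hf : ContMDiff (𝓡 (n + 1)) 𝓘(ℝ, ℝ) ∞ f) {ι : S → M}
    (hι : ContMDiff (𝓡 n) (𝓡 (n + 1)) ∞ ι) (p : S) (v w : EuclideanSpace ℝ (Fin n)) :
    fderiv ℝ (fderiv ℝ (inChart f (ι p) ∘ mapInCharts ι p)) (extChartAt (𝓡 n) p p) v w =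
      hessianForm g f (ι p) (derivInCharts ι p v) (derivInCharts ι p w) +
        fderiv ℝ (inChart f (ι p)) (extChartAt (𝓡 (n + 1)) (ι p) (ι p))
          (tangentDerivBilin g ι p v w) := by
  have hu := (contDiffAt_mapInCharts hι p).of_le (m := 2) (by norm_cast)
  have hF := (contDiffAt_inChart hf (ι p)).of_le (m := 2) (by norm_cast)
  rw [← mapInCharts_self] at hF
  rw [fderiv_fderiv_comp hu hF, mapInCharts_self, tangentDerivBilin_apply, hessianForm_apply,
    map_add]
  simp only [derivInCharts]
  -- The Christoffel term subtracted in the Hessian cancels the one added in the covariant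
  -- derivative.
  ring

/-! ### The maximum principle. -/

/-- On a maximal spacelike hypersurface the restriction of a spacetime convex function has no
maximum. -/
theorem not_isMax_of_isMaximal (hn : 1 ≤ n) {g : LorentzMetric n M} {f : M → ℝ}
    (hf : IsSpacetimeConvex g f) {ι : S → M} (hspacelike : IsSpacelikeHypersurface g ι)
    (hmaximal : IsMaximal g ι) (p : S) : ¬ ∀ q, f (ι q) ≤ f (ι p) := by
  intro hp
  obtain ⟨hsmooth, -, c, hc, hconv⟩ := hf
  have hι : ContMDiff (𝓡 n) (𝓡 (n + 1)) ∞ ι := hspacelike.1.contMDiff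
  have hmax := isLocalMax_inChart_comp (n := n) hι.continuous hp
  have hu := (contDiffAt_mapInCharts hι p).of_le (m := 2) (by norm_cast)
  have hF := (contDiffAt_inChart hsmooth (ι p)).of_le (m := 2) (by norm_cast)
  rw [← mapInCharts_self] at hF
  set P := fderiv ℝ (inChart f (ι p)) (extChartAt (𝓡 (n + 1)) (ι p) (ι p)) with hPdef
  have hP (v : EuclideanSpace ℝ (Fin n)) : P (derivInCharts ι p v) = 0 := by
    have h := hmax.fderiv_eq_zero
    rw [fderiv_comp _ (hF.differentiableAt (by simp)) (hu.differentiableAt (by simp)),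
      mapInCharts_self] at h
    exact congr($h v)
  have hpos (v : EuclideanSpace ℝ (Fin n)) (hv : v ≠ 0) : 0 < inducedBilin g ι p v v := by
    rw [← inducedMetric_eq g hι]
    exact hspacelike.2 p v hv
  have hsymm (v w : EuclideanSpace ℝ (Fin n)) : inducedBilin g ι p v w = inducedBilin g ι p w v :=
    g.symm (ι p) _ _
  obtain ⟨e, he⟩ := exists_metricForm_neg g (ι p)
  -- As `P` kills tangent vectors, it sees only the normal part of `∇_v v`, which is what `K`
  -- measures.
  obtain ⟨t, htt, htL, r, hr⟩ := exists_unit_normal (by simp) (metricForm g (ι p))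
    (g.symm (ι p)) (derivInCharts ι p).toLinearMap hpos he P.toLinearMap hP
  have hnormal : IsUnitNormal g ι p t := by
    refine ⟨htt, fun v ↦ ?_⟩
    rw [mfderiv_eq_derivInCharts hι p]
    exact htL v
  set K : LinearMap.BilinForm ℝ (EuclideanSpace ℝ (Fin n)) :=
    (tangentDerivBilin g ι p).compr₂ (metricForm g (ι p) t) with hK
  have hKeq (v w : EuclideanSpace ℝ (Fin n)) : secondFundamentalForm g ι p t v w = K v w := by
    unfold secondFundamentalForm
    rw [tangentDeriv_eq g hι]
    rfl
  set H : Matrix (Fin n) (Fin n) ℝ := Matrix.of fun i j ↦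
    inducedBilin g ι p (EuclideanSpace.single i 1) (EuclideanSpace.single j 1) with hH
  have hHpos : H.PosDef := posDef_of_single _ hsymm hpos
  obtain ⟨b, hb⟩ := exists_sum_inv_mul_eq hHpos
  have hKsum : ∑ k, K (b k) (b k) = 0 := by
    rw [← hb]
    refine Eq.trans ?_ (hmaximal p t hnormal)
    have hHeq : H = Matrix.of fun i j ↦ inducedMetric g ι p (coordVec p i) (coordVec p j) := by
      ext i j
      exact (inducedMetric_eq g hι p _ _).symm
    rw [hHeq]
    exact Finset.sum_congr rfl fun i _ ↦ Finset.sum_congr rfl fun j _ ↦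
      congrArg (_ * ·) (hKeq _ _).symm
  have hHsum : ∑ k, inducedBilin g ι p (b k) (b k) = n := by
    rw [← hb, ← sum_inv_mul_self hHpos]
    rfl
  -- The second-order condition in the direction `b k`, with the Hessian bounded below by convexity.
  have hle (k) : c * inducedBilin g ι p (b k) (b k) + r * K (b k) (b k) ≤ 0 := by
    have h1 := fderiv_fderiv_nonpos_of_isLocalMax (hF.comp _ hu) hmax (b k)
    rw [fderiv_fderiv_inChart_comp g hsmooth hι] at h1
    have h2 : c * inducedBilin g ι p (b k) (b k) ≤
        hessianForm g f (ι p) (derivInCharts ι p (b k)) (derivInCharts ι p (b k)) :=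
      hconv (ι p) (derivInCharts ι p (b k))
    have h3 : P (tangentDerivBilin g ι p (b k) (b k)) = r * K (b k) (b k) := hr _
    linarith
  have hsum := Finset.sum_nonpos fun k (_ : k ∈ Finset.univ) ↦ hle k
  rw [Finset.sum_add_distrib, ← Finset.mul_sum, ← Finset.mul_sum, hKsum, hHsum] at hsum
  -- The sum reads `c * n ≤ 0`, which is contradictory only for positive `n`.
  have : (0 : ℝ) < n := by exact_mod_cast hn
  nlinarith [mul_pos hc this]

end Spacetime

end SpacetimeConvex

theorem mainTheorem10 (n : ℕ) (hn : 1 ≤ n)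
    {M : Type*} [TopologicalSpace M] [ChartedSpace (EuclideanSpace ℝ (Fin (n + 1))) M]
    [IsManifold (𝓡 (n + 1)) ∞ M] (g : SpacetimeConvex.LorentzMetric n M)
    (hconvex : ∃ f : M → ℝ, SpacetimeConvex.IsSpacetimeConvex g f)
    {S : Type*} [TopologicalSpace S] [ChartedSpace (EuclideanSpace ℝ (Fin n)) S]
    [IsManifold (𝓡 n) ∞ S] [Nonempty S]
    (ι : S → M) (hspacelike : SpacetimeConvex.IsSpacelikeHypersurface g ι)
    (hmaximal : SpacetimeConvex.IsMaximal g ι) :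
    ¬ CompactSpace S := by
  intro _
  obtain ⟨f, hf⟩ := hconvex
  obtain ⟨p, -, hp⟩ := isCompact_univ.exists_isMaxOn (Set.univ_nonempty (α := S))
    (hf.1.continuous.comp hspacelike.1.contMDiff.continuous).continuousOn
  exact SpacetimeConvex.not_isMax_of_isMaximal hn hf hspacelike hmaximal p
    fun q ↦ hp (Set.mem_univ q)
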